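/- Let $\mathbb{F}$ be a field of characteristic $2$, let $V$ be an infinite-dimensional vector space over $\mathbb{F}$, let $\alpha \in \{0_{\mathbb{F}}, 1_{\mathbb{F}}\}$, and let $u$ be a finite-rank endomorphism of $V$ whose trace belongs to $\{0_{\mathbb{F}}, 1_{\mathbb{F}}\}$, where the trace of $u$ is the trace of the endomorphism of the finite-dimensional space $\operatorname{im} u$ induced by $u$. Then $\alpha\,\mathrm{id}_V + u$ is the sum of three idempotent endomorphisms of $V$, that is, there are endomorphisms $p, q, r$ of $V$ with $p^2 = p$, $q^2 = q$, $r^2 = r$ and $\alpha\,\mathrm{id}_V + u = p + q + r$. -/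

import Mathlib

/-- The trace of a finite-rank endomorphism `u` of a vector space `V`, which may be
infinite-dimensional: the trace of the endomorphism of the finite-dimensional space `range u`
induced by `u`. (On an infinite-dimensional space `LinearMap.trace` itself is constantly `0`.) -/
noncomputable def finiteRankTrace {K V : Type*} [Field K] [AddCommGroup V] [Module K V]
    (u : V →ₗ[K] V) : K :=
  LinearMap.trace K (LinearMap.range u)
    (u.restrict (p := LinearMap.range u) (q := LinearMap.range u)
      (fun x _ => LinearMap.mem_range_self u x))

/-! Write `u = X ∘ₗ Y` through `E = range u`, so that `Y ∘ₗ X` is the induced endomorphism of `E`.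
Suppose `Y ∘ₗ X = L + U` with `L(L+1)` and `U(U+1)` nilpotent. As `V` is infinite-dimensional, there
is room for an idempotent `e` of `V` such that subtracting the idempotent `r = e + (1-e)ue` leaves
`M`, block triangular for `range e ⊕ ker e`, with diagonal blocks governed by `L+1` and `U`. Hence
`M(M+1)` is nilpotent, and in characteristic 2 this makes `M` a sum of two idempotents: `M` is a
nilpotent plus a commuting idempotent, and the nilpotent is odd for some Z/2-grading. A nonscalar `Y
∘ₗ X` splits in this way: in a suitable basis its diagonal is zero except for one last entry, the
trace, which is 0 or 1. Scalars 0 and 1 split trivially. For any other scalar the trace condition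
forces `dim E` to be even, and an explicit block 3×3 identity applies. -/

/-! ### Sums of two idempotents in a ring of characteristic 2 -/

section Ring

variable {A : Type*} [Ring A] [CharP A 2]

/-- Oddness of `N` gives `e * N * e = 0`, so `e + N * e` and `e + e * N` are idempotent; in
characteristic 2 their sum is `N`. The idempotent `z` can be absorbed into one of them because the
cross terms appear twice. -/
theorem exists_isIdempotentElem_add_eq_of_odd {e N z : A} (he : IsIdempotentElem e)
    (hN : N = e * N + N * e) (hz : IsIdempotentElem z) (hze : Commute z e) (hzN : Commute z N) :
    ∃ p q : A, IsIdempotentElem p ∧ IsIdempotentElem q ∧ N + z = p + q := by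
  have he' : e * e = e := he
  have hz' : z * z = z := hz
  have h0 : e * N * e = 0 := by
    have h := congrArg (fun t => e * t * e) hN
    simp only [mul_add, add_mul] at h
    rw [← mul_assoc, he', ← mul_assoc, mul_assoc (e * N) e e, he'] at h
    simpa using h
  refine ⟨e + N * e, e + e * N + z, ?_, ?_, ?_⟩
  · change (e + N * e) * (e + N * e) = e + N * e
    have h1 : e * (N * e) = 0 := by rw [← mul_assoc, h0]
    have h2 : N * e * e = N * e := by rw [mul_assoc, he']
    have h3 : N * e * (N * e) = 0 := by rw [mul_assoc, h1, mul_zero]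
    rw [mul_add, add_mul, add_mul, he', h1, h2, h3, add_zero, add_zero]
  · change (e + e * N + z) * (e + e * N + z) = e + e * N + z
    have h2 : e * (e * N) = e * N := by rw [← mul_assoc, he']
    have h3 : e * N * (e * N) = 0 := by rw [← mul_assoc, h0, zero_mul]
    have h4 : z * (e * N) = e * N * z := (hze.mul_right hzN).eq
    have h5 : z * e = e * z := hze.eq
    have : (e + e * N + z) * (e + e * N + z) =
        e + e * N + z + (e * z + e * z) + (e * N * z + e * N * z) := by
      simp only [mul_add, add_mul, he', h0, h2, h3, h4, h5, hz']
      abel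
    rw [this, CharTwo.add_self_eq_zero, CharTwo.add_self_eq_zero, add_zero, add_zero]
  · have : e + N * e + (e + e * N + z) = (e + e) + (e * N + N * e) + z := by abel
    rw [this, ← hN, CharTwo.add_self_eq_zero, zero_add]

/-- By Frobenius, `(M² + M) ^ 2 ^ k = 0` says exactly that `M ^ 2 ^ k` is idempotent; this power is
`z`. -/
theorem exists_isIdempotentElem_isNilpotent_add {M : A} (hM : IsNilpotent (M * (M + 1))) :
    ∃ N z : A, M = N + z ∧ IsNilpotent N ∧ IsIdempotentElem z ∧ Commute z N := by
  obtain ⟨k, hk⟩ := hM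
  have hk' : (M * (M + 1)) ^ 2 ^ k = 0 := pow_eq_zero_of_le Nat.lt_two_pow_self.le hk
  have hz : M ^ 2 ^ k * M ^ 2 ^ k = M ^ 2 ^ k := by
    have : M * (M + 1) = M * M + M := by rw [mul_add, mul_one]
    rw [this, add_pow_char_pow_of_commute _ _ ((Commute.refl M).mul_left (Commute.refl M)),
      (Commute.refl M).mul_pow, CharTwo.add_eq_zero] at hk'
    exact hk'
  have hz2 : ∀ n, (M ^ 2 ^ k) ^ (n + 1) = M ^ 2 ^ k := fun n =>
    IsIdempotentElem.pow_succ_eq n hz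
  have hc : Commute (M ^ 2 ^ k) M := (Commute.refl M).pow_left _
  refine ⟨M + M ^ 2 ^ k, M ^ 2 ^ k, ?_, ⟨2 ^ k, ?_⟩, hz, hc.add_right (Commute.refl _)⟩
  · rw [add_assoc, CharTwo.add_self_eq_zero, add_zero]
  · rw [add_pow_char_pow_of_commute _ _ hc.symm, CharTwo.add_eq_zero]
    have := hz2 (2 ^ k - 1)
    rw [Nat.sub_add_cancel Nat.one_le_two_pow] at this
    exact this.symm

end Ring

/-! ### Z/2-gradings making a nilpotent endomorphism odd -/

section Grading

variable {K V : Type*} [Field K] [AddCommGroup V] [Module K V]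

theorem Submodule.exists_le_disjoint_sup_eq {E' Z Q : Submodule K V} (hE : E' ≤ Q) (hZ : Z ≤ Q)
    (h : Disjoint E' Z) : ∃ E, E' ≤ E ∧ Disjoint E Z ∧ E ⊔ Z = Q := by
  obtain ⟨C, hC⟩ := exists_isCompl (E' ⊔ Z)
  refine ⟨C ⊓ Q ⊔ E', le_sup_right, ?_, ?_⟩
  · refine h.disjoint_sup_left_of_disjoint_sup_right ?_
    exact hC.disjoint.symm.mono_left inf_le_left
  · rw [sup_assoc, sup_comm, ← sup_inf_assoc_of_le _ (sup_le hE hZ), hC.sup_eq_top, top_inf_eq]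

/-- Induction on the nilpotency index, valid in any dimension: a grading `E' ⊕ O'` of `N(P)` is
pulled back along `N`. Vectors of `P` sent into `O'` should be even and those sent into `E'` odd;
the ambiguity lies in `ker N` and is removed by the choice of complements. -/
theorem Submodule.exists_odd_grading (N : V →ₗ[K] V) (k : ℕ) (P : Submodule K V)
    (hP : P ≤ P.comap N) (hk : P ≤ LinearMap.ker (N ^ k)) :
    ∃ E O : Submodule K V, Disjoint E O ∧ E ⊔ O = P ∧ E ≤ O.comap N ∧ O ≤ E.comap N := by
  induction k generalizing P with
  | zero =>
    have : P = ⊥ := by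
      rw [pow_zero, Module.End.one_eq_id, LinearMap.ker_id] at hk
      exact le_bot_iff.mp hk
    exact ⟨⊥, ⊥, disjoint_bot_left, by simp [this], bot_le, bot_le⟩
  | succ k ih =>
    have hNP : P.map N ≤ P := Submodule.map_le_iff_le_comap.mpr hP
    obtain ⟨E', O', hd, hs, hEO, hOE⟩ := ih (P.map N)
      (Submodule.map_le_iff_le_comap.mp (Submodule.map_mono hNP)) (by
        rintro _ ⟨v, hv, rfl⟩
        have := hk hv
        rwa [pow_succ] at this)
    have hE'P : E' ≤ P := (le_sup_left.trans hs.le).trans hNP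
    have hO'P : O' ≤ P := (le_sup_right.trans hs.le).trans hNP
    have ker_le : ∀ S : Submodule K V, LinearMap.ker N ≤ S.comap N := fun S v hv => by
      rw [Submodule.mem_comap, LinearMap.mem_ker.mp hv]
      exact S.zero_mem
    obtain ⟨E, hE'E, hEZ, hEs⟩ := Submodule.exists_le_disjoint_sup_eq
      (E' := E') (Z := O' ⊓ LinearMap.ker N) (Q := P ⊓ O'.comap N) (le_inf hE'P hEO)
      (inf_le_inf hO'P (ker_le _)) (hd.mono_right inf_le_left)
    have hEP : E ≤ P ⊓ O'.comap N := le_sup_left.trans hEs.le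
    obtain ⟨O, hO'O, hOZ, hOs⟩ := Submodule.exists_le_disjoint_sup_eq
      (E' := O') (Z := E ⊓ LinearMap.ker N) (Q := P ⊓ E'.comap N) (le_inf hO'P hOE)
      (inf_le_inf (hEP.trans inf_le_left) (ker_le _)) (by
        rw [disjoint_iff_inf_le] at hEZ ⊢
        refine le_trans ?_ hEZ
        exact fun v ⟨h1, h2, h3⟩ => ⟨h2, h1, h3⟩)
    have hOP : O ≤ P ⊓ E'.comap N := le_sup_left.trans hOs.le
    refine ⟨E, O, ?_, le_antisymm (sup_le (hEP.trans inf_le_left) (hOP.trans inf_le_left)) ?_,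
      (hEP.trans inf_le_right).trans (Submodule.comap_mono hO'O),
      (hOP.trans inf_le_right).trans (Submodule.comap_mono hE'E)⟩
    · rw [disjoint_iff_inf_le] at hOZ hd ⊢
      exact fun v ⟨h1, h2⟩ => hOZ ⟨h2, h1, hd ⟨(hOP h2).2, (hEP h1).2⟩⟩
    · have hQE : P ⊓ E'.comap N ≤ E ⊔ O :=
        hOs.ge.trans (sup_le le_sup_right (inf_le_left.trans le_sup_left))
      have hQO : P ⊓ O'.comap N ≤ E ⊔ O :=
        hEs.ge.trans (sup_le le_sup_left ((inf_le_left.trans hO'O).trans le_sup_right))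
      intro v hv
      have hNv : N v ∈ E' ⊔ O' := hs ▸ Submodule.mem_map_of_mem hv
      obtain ⟨a, ha, b, hb, hab⟩ := Submodule.mem_sup.mp hNv
      obtain ⟨w, hw, rfl⟩ : a ∈ P.map N := hs ▸ Submodule.mem_sup_left ha
      have h1 : w ∈ E ⊔ O := hQE ⟨hw, ha⟩
      have h2 : v - w ∈ E ⊔ O := hQO ⟨P.sub_mem hv hw, by
        change N (v - w) ∈ O'
        rwa [map_sub, ← hab, add_sub_cancel_left]⟩
      simpa using Submodule.add_mem _ h1 h2

theorem LinearMap.exists_odd_idempotent {N z : Module.End K V} (hN : IsNilpotent N)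
    (hz : IsIdempotentElem z) (hzN : Commute z N) :
    ∃ e : Module.End K V, IsIdempotentElem e ∧ N = e * N + N * e ∧ Commute z e := by
  obtain ⟨k, hk⟩ := hN
  have hzN' : ∀ v, z (N v) = N (z v) := fun v => LinearMap.congr_fun hzN.eq v
  have hzz : ∀ v, z (z v) = z v := fun v => LinearMap.congr_fun hz v
  have hle : ∀ P : Submodule K V, P ≤ LinearMap.ker (N ^ k) := fun P => by
    rw [hk]; exact fun v _ => rfl
  -- Grading `ker z` and `range z` separately makes the even projection commute with `z`.
  obtain ⟨E₀, O₀, hd₀, hs₀, hEO₀, hOE₀⟩ := Submodule.exists_odd_grading N k (LinearMap.ker z)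
    (fun v hv => by
      rw [Submodule.mem_comap, LinearMap.mem_ker, hzN', LinearMap.mem_ker.mp hv, map_zero]) (hle _)
  obtain ⟨E₁, O₁, hd₁, hs₁, hEO₁, hOE₁⟩ := Submodule.exists_odd_grading N k (LinearMap.range z)
    (by rintro _ ⟨v, rfl⟩; exact ⟨N v, hzN' v⟩) (hle _)
  have zE₀ : ∀ v ∈ E₀, z v = 0 := fun v hv => (le_sup_left.trans hs₀.le) hv
  have zO₀ : ∀ v ∈ O₀, z v = 0 := fun v hv => (le_sup_right.trans hs₀.le) hv
  have zE₁ : ∀ v ∈ E₁, z v = v := fun v hv => by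
    obtain ⟨w, rfl⟩ := (le_sup_left.trans hs₁.le) hv
    exact hzz w
  have zO₁ : ∀ v ∈ O₁, z v = v := fun v hv => by
    obtain ⟨w, rfl⟩ := (le_sup_right.trans hs₁.le) hv
    exact hzz w
  have hc : IsCompl (E₀ ⊔ E₁) (O₀ ⊔ O₁) := by
    constructor
    · rw [Submodule.disjoint_def] at hd₀ hd₁ ⊢
      intro v h1 h2
      obtain ⟨a, ha, b, hb, rfl⟩ := Submodule.mem_sup.mp h1
      obtain ⟨c, hc, d, hd, h⟩ := Submodule.mem_sup.mp h2
      have hbd : d = b := by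
        have := congrArg z h
        simpa [zE₀ a ha, zE₁ b hb, zO₀ c hc, zO₁ d hd] using this
      subst hbd
      have hac : c = a := add_right_cancel h
      subst hac
      rw [hd₀ c ha hc, hd₁ d hb hd, add_zero]
    · rw [codisjoint_iff_le_sup]
      intro v _
      have h1 : v - z v ∈ E₀ ⊔ O₀ := by rw [hs₀, LinearMap.mem_ker, map_sub, hzz, sub_self]
      have h2 : z v ∈ E₁ ⊔ O₁ := by rw [hs₁]; exact ⟨v, rfl⟩
      have h3 : E₀ ⊔ O₀ ≤ E₀ ⊔ E₁ ⊔ (O₀ ⊔ O₁) := sup_le_sup le_sup_left le_sup_left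
      have h4 : E₁ ⊔ O₁ ≤ E₀ ⊔ E₁ ⊔ (O₀ ⊔ O₁) := sup_le_sup le_sup_right le_sup_right
      simpa using Submodule.add_mem _ (h3 h1) (h4 h2)
  have hEO : E₀ ⊔ E₁ ≤ (O₀ ⊔ O₁).comap N :=
    sup_le (hEO₀.trans (Submodule.comap_mono le_sup_left))
      (hEO₁.trans (Submodule.comap_mono le_sup_right))
  have hOE : O₀ ⊔ O₁ ≤ (E₀ ⊔ E₁).comap N :=
    sup_le (hOE₀.trans (Submodule.comap_mono le_sup_left))
      (hOE₁.trans (Submodule.comap_mono le_sup_right))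
  have hzE : E₀ ⊔ E₁ ≤ (E₀ ⊔ E₁).comap z := by
    refine sup_le (fun v hv => ?_) (fun v hv => ?_)
    · rw [Submodule.mem_comap, zE₀ v hv]; exact Submodule.zero_mem _
    · rw [Submodule.mem_comap, zE₁ v hv]; exact Submodule.mem_sup_right hv
  have hzO : O₀ ⊔ O₁ ≤ (O₀ ⊔ O₁).comap z := by
    refine sup_le (fun v hv => ?_) (fun v hv => ?_)
    · rw [Submodule.mem_comap, zO₀ v hv]; exact Submodule.zero_mem _
    · rw [Submodule.mem_comap, zO₁ v hv]; exact Submodule.mem_sup_right hv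
  generalize E₀ ⊔ E₁ = E at *
  generalize O₀ ⊔ O₁ = O at *
  have key : ∀ f g : Module.End K V, (∀ v ∈ E, f v = g v) → (∀ v ∈ O, f v = g v) → f = g := by
    intro f g h1 h2
    ext v
    obtain ⟨a, ha, b, hb, rfl⟩ := Submodule.mem_sup.mp
      (show v ∈ E ⊔ O by rw [hc.sup_eq_top]; trivial)
    rw [map_add, map_add, h1 a ha, h2 b hb]
  have eE : ∀ v ∈ E, E.projection O hc v = v := fun v hv =>
    Submodule.projection_apply_of_mem_left hc hv
  have eO : ∀ v ∈ O, E.projection O hc v = 0 := fun v hv =>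
    Submodule.projection_apply_of_mem_right hc hv
  refine ⟨E.projection O hc, key _ _ ?_ ?_, key _ _ ?_ ?_, key _ _ ?_ ?_⟩ <;> intro v hv
  · simp [eE v hv]
  · simp [eO v hv]
  · simp [eE v hv, eO _ (hEO hv)]
  · simp [eO v hv, eE _ (hOE hv)]
  · simp [eE v hv, eE _ (hzE hv)]
  · simp [eO v hv, eO _ (hzO hv)]

theorem LinearMap.exists_isIdempotentElem_add_eq [CharP K 2] {M : Module.End K V}
    (hM : IsNilpotent (M * (M + 1))) :
    ∃ p q : Module.End K V, IsIdempotentElem p ∧ IsIdempotentElem q ∧ M = p + q := by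
  rcases subsingleton_or_nontrivial V with h | h
  · exact ⟨0, 0, .zero, .zero, Subsingleton.elim _ _⟩
  have : CharP (Module.End K V) 2 :=
    charP_of_injective_algebraMap (algebraMap K (Module.End K V)).injective 2
  obtain ⟨N, z, rfl, hN, hz, hzN⟩ := exists_isIdempotentElem_isNilpotent_add hM
  obtain ⟨e, he, hNe, hze⟩ := LinearMap.exists_odd_idempotent hN hz hzN
  exact exists_isIdempotentElem_add_eq_of_odd he hNe hz hze hzN

end Grading

/-! ### Removing one idempotent from `X ∘ₗ Y` -/

section Compression

variable {K V E : Type*} [Field K] [AddCommGroup V] [Module K V] [AddCommGroup E] [Module K E]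

theorem Submodule.exists_injective_ker_disjoint [FiniteDimensional K E]
    (hV : ¬ FiniteDimensional K V) (Y : V →ₗ[K] E) (F : Submodule K V) [FiniteDimensional K F]
    (G : Type*) [AddCommGroup G] [Module K G] [FiniteDimensional K G] :
    ∃ ζ : G →ₗ[K] V, Function.Injective ζ ∧ Y ∘ₗ ζ = 0 ∧ Disjoint (LinearMap.range ζ) F := by
  have hker : ¬ FiniteDimensional K (LinearMap.ker Y) := fun h => hV <| by
    have : FiniteDimensional K (V ⧸ LinearMap.ker Y) :=
      LinearEquiv.finiteDimensional Y.quotKerEquivRange.symm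
    exact Module.Finite.of_submodule_quotient (LinearMap.ker Y)
  obtain ⟨C, -, hd, hs⟩ := Submodule.exists_le_disjoint_sup_eq (E' := (⊥ : Submodule K V))
    (Z := F ⊓ LinearMap.ker Y) (Q := LinearMap.ker Y) bot_le inf_le_right disjoint_bot_left
  have hC : ¬ FiniteDimensional K C := fun h => hker <| by
    have : FiniteDimensional K (F ⊓ LinearMap.ker Y : Submodule K V) :=
      Submodule.finiteDimensional_of_le inf_le_left
    rw [← hs]
    infer_instance
  have hCY : C ≤ LinearMap.ker Y := le_sup_left.trans hs.le
  obtain ⟨f, hf⟩ := Module.Free.exists_linearMap_injective_of_lift_rank_lt (R := K) (M := G)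
    (N' := C) (by
      refine lt_of_lt_of_le (Cardinal.lift_lt_aleph0.mpr (Module.rank_lt_aleph0 K G))
        (Cardinal.aleph0_le_lift.mpr ?_)
      rwa [← not_lt, Module.rank_lt_aleph0_iff])
  refine ⟨C.subtype ∘ₗ f, C.injective_subtype.comp hf, ?_, ?_⟩
  · ext v
    exact hCY (f v).2
  · rw [disjoint_iff_inf_le] at hd ⊢
    rintro _ ⟨⟨v, rfl⟩, h⟩
    exact hd ⟨(f v).2, h, hCY (f v).2⟩

/-- `W` is a lift of `L` through a section of `Y`, perturbed inside `ker Y` by an injection whose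
range avoids everything else; then `X` and `W` are jointly injective. -/
theorem LinearMap.exists_common_leftInverse_of_comp_eq [FiniteDimensional K E]
    (hV : ¬ FiniteDimensional K V) (X : E →ₗ[K] V) (Y : V →ₗ[K] E)
    (hX : Function.Injective X) (hY : Function.Surjective Y) (L : Module.End K E) :
    ∃ (W : E →ₗ[K] V) (φ : V →ₗ[K] E), Y ∘ₗ W = L ∧ φ ∘ₗ X = .id ∧ φ ∘ₗ W = .id := by
  obtain ⟨s, hs⟩ := Y.exists_rightInverse_of_surjective (LinearMap.range_eq_top.mpr hY)
  obtain ⟨ζ, hζ, hYζ, hd⟩ := Submodule.exists_injective_ker_disjoint hV Y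
    (LinearMap.range X ⊔ LinearMap.range s) E
  rw [Submodule.disjoint_def] at hd
  have hinj : LinearMap.ker (X.coprod (s ∘ₗ L + ζ)) = ⊥ := by
    rw [LinearMap.ker_eq_bot']
    rintro ⟨v, w⟩ h
    replace h : X v + (s (L w) + ζ w) = 0 := h
    have h0 : ζ w = 0 := by
      refine hd _ ⟨w, rfl⟩ ?_
      rw [← add_assoc] at h
      rw [eq_neg_of_add_eq_zero_right h]
      exact neg_mem (Submodule.add_mem_sup ⟨v, rfl⟩ ⟨L w, rfl⟩)
    have hw : w = 0 := hζ (by rw [h0, map_zero])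
    subst hw
    have hv : v = 0 := hX (by simpa using h)
    rw [hv, Prod.mk_zero_zero]
  obtain ⟨g, hg⟩ := LinearMap.exists_leftInverse_of_injective _ hinj
  have hg' : ∀ v w, g (X v + (s (L w) + ζ w)) = (v, w) := fun v w => LinearMap.congr_fun hg (v, w)
  refine ⟨s ∘ₗ L + ζ, (LinearMap.coprod .id .id) ∘ₗ g, ?_, ?_, ?_⟩ <;> ext v
  · have h1 : Y (s (L v)) = L v := LinearMap.congr_fun hs _
    have h2 : Y (ζ v) = 0 := LinearMap.congr_fun hYζ v
    simp [h1, h2]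
  · have := hg' v 0
    simp only [map_zero, add_zero] at this
    simp [this]
  · have := hg' 0 v
    simp only [map_zero, zero_add] at this
    simp only [LinearMap.comp_apply, LinearMap.add_apply]
    simp [this]

theorem LinearMap.exists_three_idempotents_of_comp_eq_add [CharP K 2] [FiniteDimensional K E]
    (hV : ¬ FiniteDimensional K V) (X : E →ₗ[K] V) (Y : V →ₗ[K] E)
    (hX : Function.Injective X) (hY : Function.Surjective Y) (L U : Module.End K E)
    (hLU : Y ∘ₗ X = L + U) (hL : IsNilpotent (L * (L + 1))) (hU : IsNilpotent (U * (U + 1))) :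
    ∃ p q r : Module.End K V, IsIdempotentElem p ∧ IsIdempotentElem q ∧ IsIdempotentElem r ∧
      X ∘ₗ Y = p + q + r := by
  obtain ⟨W, φ, hYW, hφX, hφW⟩ := LinearMap.exists_common_leftInverse_of_comp_eq hV X Y hX hY L
  have : Nontrivial V := by
    by_contra h
    rw [not_nontrivial_iff_subsingleton] at h
    exact hV inferInstance
  have : CharP (Module.End K V) 2 :=
    charP_of_injective_algebraMap (algebraMap K (Module.End K V)).injective 2
  set e : Module.End K V := W ∘ₗ φ with he_def
  set u : Module.End K V := X ∘ₗ Y with hu_def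
  have yw : ∀ v, Y (W v) = L v := LinearMap.congr_fun hYW
  have fx : ∀ v, φ (X v) = v := LinearMap.congr_fun hφX
  have fw : ∀ v, φ (W v) = v := LinearMap.congr_fun hφW
  have yx : ∀ v, Y (X v) = L v + U v := LinearMap.congr_fun hLU
  have he : IsIdempotentElem e := by
    ext v
    simp [he_def, fw]
  have he' : e * e = e := he
  have hef : e * (1 - e) = 0 := by rw [mul_sub, he', mul_one, sub_self]
  -- This idempotent has the same lower-left block as `u` for `range e ⊕ ker e`, so `u` minus it
  -- preserves `range e = range W`.
  have hr : IsIdempotentElem (e + (1 - e) * u * e) := by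
    change (e + (1 - e) * u * e) * (e + (1 - e) * u * e) = e + (1 - e) * u * e
    have h1 : e * ((1 - e) * u * e) = 0 := by rw [← mul_assoc, ← mul_assoc, hef, zero_mul, zero_mul]
    have h2 : (1 - e) * u * e * e = (1 - e) * u * e := by rw [mul_assoc, he']
    rw [mul_add, add_mul, add_mul, he', h1, h2, mul_assoc _ e, h1, mul_zero, add_zero, add_zero]
  have hnil : IsNilpotent ((u - (e + (1 - e) * u * e)) * ((u - (e + (1 - e) * u * e)) + 1)) := by
    set M := u - (e + (1 - e) * u * e) with hM
    have hMv : ∀ v, M v = u v - (e v + (u (e v) - e (u (e v)))) := fun v => rfl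
    have two : ∀ v : E, -v = v := fun v => by
      rw [← neg_one_smul K v, CharTwo.neg_eq, one_smul]
    have hMW : M ∘ₗ W = W ∘ₗ (L + 1) := by
      ext v
      have h : M (W v) = W (L v + -v) := by
        rw [hMv]
        simp only [he_def, hu_def, LinearMap.comp_apply, fw, yw, fx, map_add, map_neg]
        abel
      simpa [two] using h
    have hYM : (Y - L ∘ₗ φ) ∘ₗ M = U ∘ₗ (Y - L ∘ₗ φ) := by
      ext v
      simp only [LinearMap.comp_apply, LinearMap.sub_apply, hMv, he_def, hu_def, map_add, map_sub,
        fw, yw, fx, yx]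
      abel
    have hfM : ∀ v, M v - e (M v) = (X - W) ((Y - L ∘ₗ φ) v) := by
      intro v
      simp only [LinearMap.comp_apply, LinearMap.sub_apply, hMv, he_def, hu_def, map_add, map_sub,
        fw, yw, fx]
      abel
    have hTW : (M * (M + 1)) ∘ₗ W = W ∘ₗ (L * (L + 1)) := by
      have h1 : (M + 1) ∘ₗ W = W ∘ₗ L := by
        rw [LinearMap.add_comp, hMW]
        ext v
        have h : v + v = 0 := by nth_rewrite 1 [← two v]; exact neg_add_cancel v
        change W (L v + v) + W v = W (L v)
        rw [← map_add, add_assoc, h, add_zero]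
      have hc : L * (L + 1) = (L + 1) * L := by rw [mul_add, add_mul, mul_one, one_mul]
      rw [hc, Module.End.mul_eq_comp, LinearMap.comp_assoc, h1, ← LinearMap.comp_assoc, hMW]
      rfl
    have hYT : (Y - L ∘ₗ φ) ∘ₗ (M * (M + 1)) = (U * (U + 1)) ∘ₗ (Y - L ∘ₗ φ) := by
      have h1 : (Y - L ∘ₗ φ) ∘ₗ (M + 1) = (U + 1) ∘ₗ (Y - L ∘ₗ φ) := by
        rw [LinearMap.comp_add, hYM]
        rfl
      rw [Module.End.mul_eq_comp, ← LinearMap.comp_assoc, hYM, LinearMap.comp_assoc, h1]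
      rfl
    obtain ⟨m, hm⟩ := hL
    obtain ⟨n, hn⟩ := hU
    have hTm : ∀ v, ((M * (M + 1)) ^ m) (W v) = 0 := fun v => by
      have := LinearMap.congr_fun (Module.End.commute_pow_left_of_commute hTW m) v
      simpa [hm] using this
    have hTn : ∀ v, (Y - L ∘ₗ φ) (((M * (M + 1)) ^ n) v) = 0 := fun v => by
      have := LinearMap.congr_fun (Module.End.commute_pow_left_of_commute hYT.symm n) v
      rw [hn] at this
      exact this.symm
    -- After `n` factors `Y - L ∘ₗ φ` vanishes; one more lands in `range W`, where `m` factors give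
    -- zero.
    refine ⟨m + (n + 1), ?_⟩
    ext v
    have h1 : ((M * (M + 1)) ^ (n + 1)) v = M ((M + 1) (((M * (M + 1)) ^ n) v)) := by
      rw [pow_succ']; rfl
    have h2 : (Y - L ∘ₗ φ) ((M + 1) (((M * (M + 1)) ^ n) v)) = 0 := by
      have := LinearMap.congr_fun hYM (((M * (M + 1)) ^ n) v)
      rw [LinearMap.comp_apply, LinearMap.comp_apply, hTn, map_zero] at this
      rw [LinearMap.add_apply, map_add, this, Module.End.one_apply, hTn, add_zero]
    have h3 := hfM ((M + 1) (((M * (M + 1)) ^ n) v))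
    rw [h2, map_zero, sub_eq_zero, ← h1] at h3
    rw [pow_add, Module.End.mul_apply, h3, he_def, LinearMap.comp_apply, hTm, LinearMap.zero_apply]
  obtain ⟨p, q, hp, hq, hpq⟩ := LinearMap.exists_isIdempotentElem_add_eq hnil
  exact ⟨p, q, _, hp, hq, hr, by rw [← hpq, sub_add_cancel]⟩

end Compression

/-! ### Splitting a nonscalar endomorphism of trace 0 or 1 -/

section Splitting

universe v

variable {K : Type*} [Field K]

theorem LinearMap.isNilpotent_mul_add_one_of_comp {V E : Type*} [AddCommGroup V] [Module K V]
    [AddCommGroup E] [Module K E] {X : E →ₗ[K] V} {Y : V →ₗ[K] E} {S : Module.End K E}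
    {T : Module.End K V} (hS : Y ∘ₗ X = S) (hT : X ∘ₗ Y = T) (h : IsNilpotent (S * (S + 1))) :
    IsNilpotent (T * (T + 1)) := by
  subst hS hT
  obtain ⟨k, hk⟩ := h
  have hX : ((X ∘ₗ Y) * (X ∘ₗ Y + 1) : Module.End K V) ∘ₗ X =
      X ∘ₗ ((Y ∘ₗ X) * (Y ∘ₗ X + 1) : Module.End K E) := by
    ext v
    simp
  refine ⟨k + 1, ?_⟩
  ext v
  have := LinearMap.congr_fun (Module.End.commute_pow_left_of_commute hX k) (Y (X (Y v) + v))
  rw [hk] at this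
  simpa [pow_succ] using this

variable {E : Type v} [AddCommGroup E] [Module K E]

theorem LinearIndependent.exists_dual_apply_eq {ι : Type*} {b : ι → E}
    (hb : LinearIndependent K b) (c : ι → K) : ∃ ψ : E →ₗ[K] K, ∀ i, ψ (b i) = c i := by
  obtain ⟨g, hg⟩ := LinearMap.exists_leftInverse_of_injective _ (LinearMap.ker_eq_bot.mpr hb)
  refine ⟨Finsupp.linearCombination K c ∘ₗ g, fun i => ?_⟩
  have := LinearMap.congr_fun hg (Finsupp.single i 1)
  simp only [LinearMap.comp_apply, Finsupp.linearCombination_single, one_smul,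
    LinearMap.id_apply] at this
  simp [this]

/-- The projection of `E` onto the hyperplane `ker ψ` along the vector `x`. -/
def LinearMap.kerProj (ψ : E →ₗ[K] K) (x : E) (hx : ψ x = 1) : E →ₗ[K] LinearMap.ker ψ :=
  LinearMap.codRestrict _ (LinearMap.id - ψ.smulRight x) fun v => by simp [hx]

theorem LinearMap.coe_kerProj (ψ : E →ₗ[K] K) (x : E) (hx : ψ x = 1) (v : E) :
    (ψ.kerProj x hx v : E) = v - ψ v • x := rfl

theorem LinearMap.kerProj_coe (ψ : E →ₗ[K] K) (x : E) (hx : ψ x = 1) (h : LinearMap.ker ψ) :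
    ψ.kerProj x hx h = h := by
  ext
  rw [LinearMap.coe_kerProj, LinearMap.mem_ker.mp h.2, zero_smul, sub_zero]

theorem LinearMap.kerProj_self (ψ : E →ₗ[K] K) (x : E) (hx : ψ x = 1) :
    ψ.kerProj x hx x = 0 := by
  ext
  rw [LinearMap.coe_kerProj, hx, one_smul, sub_self, Submodule.coe_zero]

theorem LinearMap.eq_of_kerProj (a : Module.End K E) (ψ : E →ₗ[K] K) (x : E) (hx : ψ x = 1) :
    a = (LinearMap.ker ψ).subtype ∘ₗ
          (ψ.kerProj x hx ∘ₗ a ∘ₗ (LinearMap.ker ψ).subtype) ∘ₗ ψ.kerProj x hx +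
        ψ.smulRight (a x) +
        (ψ ∘ₗ a ∘ₗ (LinearMap.ker ψ).subtype ∘ₗ ψ.kerProj x hx).smulRight x := by
  ext v
  simp only [LinearMap.add_apply, LinearMap.comp_apply, LinearMap.smulRight_apply,
    Submodule.subtype_apply, LinearMap.coe_kerProj, map_sub, map_smul]
  module

theorem LinearMap.trace_kerProj_comp [FiniteDimensional K E] (a : Module.End K E)
    (ψ : E →ₗ[K] K) (x : E) (hx : ψ x = 1) (hax : ψ (a x) = 0) :
    LinearMap.trace K _ (ψ.kerProj x hx ∘ₗ a ∘ₗ (LinearMap.ker ψ).subtype) =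
      LinearMap.trace K E a := by
  have hid : ψ.kerProj x hx ∘ₗ (LinearMap.ker ψ).subtype = LinearMap.id :=
    LinearMap.ext fun h => ψ.kerProj_coe x hx h
  have h := congrArg (LinearMap.trace K E) (LinearMap.eq_of_kerProj a ψ x hx)
  rw [map_add, map_add, LinearMap.trace_smulRight, LinearMap.trace_smulRight, hax,
    LinearMap.trace_comp_comm' _ (LinearMap.ker ψ).subtype, LinearMap.comp_assoc, hid,
    LinearMap.comp_id] at h
  simpa [LinearMap.kerProj_self] using h.symm

/-- In `K x ⊕ ker ψ` the corner entry of `a` is zero: its column `a x` joins `L`, its row joins `U`.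
Both enlarged maps factor through `ker ψ`, with reversed composites `L` and `U`. -/
theorem LinearMap.exists_splitting_of_kerProj (a : Module.End K E)
    (ψ : E →ₗ[K] K) (x : E) (hx : ψ x = 1) (hax : ψ (a x) = 0)
    (h : ∃ L U : Module.End K (LinearMap.ker ψ),
      ψ.kerProj x hx ∘ₗ a ∘ₗ (LinearMap.ker ψ).subtype = L + U ∧
      IsNilpotent (L * (L + 1)) ∧ IsNilpotent (U * (U + 1))) :
    ∃ L U : Module.End K E, a = L + U ∧
      IsNilpotent (L * (L + 1)) ∧ IsNilpotent (U * (U + 1)) := by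
  obtain ⟨L, U, hLU, hL, hU⟩ := h
  refine ⟨(LinearMap.ker ψ).subtype ∘ₗ
      (L ∘ₗ ψ.kerProj x hx + ψ.smulRight (⟨a x, hax⟩ : LinearMap.ker ψ)),
    ((LinearMap.ker ψ).subtype ∘ₗ U + (ψ ∘ₗ a ∘ₗ (LinearMap.ker ψ).subtype).smulRight x) ∘ₗ
      ψ.kerProj x hx, ?_, ?_, ?_⟩
  · conv_lhs => rw [LinearMap.eq_of_kerProj a ψ x hx, hLU]
    ext v
    simp only [LinearMap.add_apply, LinearMap.comp_apply, LinearMap.smulRight_apply, map_add,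
      map_smul, Submodule.subtype_apply]
    abel
  · refine LinearMap.isNilpotent_mul_add_one_of_comp ?_ rfl hL
    ext v
    simp [LinearMap.kerProj_coe]
  · refine LinearMap.isNilpotent_mul_add_one_of_comp ?_ rfl hU
    ext v
    simp [LinearMap.kerProj_coe, LinearMap.kerProj_self]

theorem LinearMap.exists_splitting_smul_one [CharP K 2] {c : K} (hc : c = 0 ∨ c = 1) :
    ∃ L U : Module.End K E, c • (1 : Module.End K E) = L + U ∧
      IsNilpotent (L * (L + 1)) ∧ IsNilpotent (U * (U + 1)) := by
  refine ⟨c • 1, 0, by simp, ?_, by simp⟩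
  rcases hc with rfl | rfl
  · simp
  · have : (1 : Module.End K E) + 1 = 0 := by
      rw [← one_smul K (1 : Module.End K E), ← add_smul, CharTwo.add_self_eq_zero, zero_smul]
    simp [this]

theorem LinearMap.exists_dual_kerProj_ne_smul_one [FiniteDimensional K E] (a : Module.End K E)
    (x : E) (hx : LinearIndependent K ![x, a x]) :
    ∃ (ψ : E →ₗ[K] K) (h1 : ψ x = 1), ψ (a x) = 0 ∧
      ((∀ c : K, ψ.kerProj x h1 ∘ₗ a ∘ₗ (LinearMap.ker ψ).subtype ≠ c • (1 : Module.End K _)) ∨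
        Module.finrank K (LinearMap.ker ψ) = 1) := by
  obtain ⟨ψ, hψ⟩ := hx.exists_dual_apply_eq ![1, 0]
  have h1 : ψ x = 1 := hψ 0
  have h0 : ψ (a x) = 0 := hψ 1
  by_cases hc : ∃ c : K, ψ.kerProj x h1 ∘ₗ a ∘ₗ (LinearMap.ker ψ).subtype =
      c • (1 : Module.End K _)
  swap
  · push Not at hc
    exact ⟨ψ, h1, h0, .inl hc⟩
  obtain ⟨c, hc⟩ := hc
  by_cases hd : Module.finrank K (LinearMap.ker ψ) = 1
  · exact ⟨ψ, h1, h0, .inr hd⟩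
  have hax : a x ≠ 0 := by simpa using hx.ne_zero 1
  obtain ⟨h, hh⟩ : ∃ h : LinearMap.ker ψ, ∀ t : K, t • a x ≠ h := by
    by_contra! hall
    refine hd (finrank_eq_one (⟨a x, h0⟩ : LinearMap.ker ψ) (fun h => hax congr(($h : E))) ?_)
    intro w
    obtain ⟨t, ht⟩ := hall w
    exact ⟨t, Subtype.ext ht⟩
  have hli : LinearIndependent K ![(h : E), x, a x] := by
    refine linearIndependent_finCons.mpr ⟨hx, fun hmem => ?_⟩
    rw [Matrix.range_cons, Matrix.range_cons, Matrix.range_empty, Set.union_empty,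
      Set.singleton_union, Submodule.mem_span_pair] at hmem
    obtain ⟨s, t, hst⟩ := hmem
    have hs := congrArg ψ hst
    rw [map_add, map_smul, map_smul, h1, h0, LinearMap.mem_ker.mp h.2] at hs
    have hs0 : s = 0 := by simpa using hs
    rw [hs0, zero_smul, zero_add] at hst
    exact hh t hst
  -- Now `h - x ∈ ker χ`. Were this compression scalar too, `a h` and `a (h - x)` would both lie in
  -- the span of `h` and `x`, hence so would `a x`.
  obtain ⟨χ, hχ⟩ := hli.exists_dual_apply_eq ![1, 1, 0]
  have e1 : χ h = 1 := hχ 0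
  have e2 : χ x = 1 := hχ 1
  have e3 : χ (a x) = 0 := hχ 2
  refine ⟨χ, e2, e3, .inl fun d hd' => ?_⟩
  have k1 : a h - ψ (a h) • x = c • (h : E) :=
    congrArg Subtype.val (LinearMap.congr_fun hc h)
  have k2 : a (h - x) - χ (a (h - x)) • x = d • ((h : E) - x) :=
    congrArg Subtype.val (LinearMap.congr_fun hd' ⟨(h : E) - x, by
      rw [LinearMap.mem_ker, map_sub, e1, e2, sub_self]⟩)
  rw [map_sub] at k2
  have k3 := Fintype.linearIndependent_iff.mp hli ![c - d, ψ (a h) - χ (a h - a x) + d, -1] (by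
    rw [Fin.sum_univ_three]
    simp only [Matrix.cons_val_zero, Matrix.cons_val_one, Matrix.cons_val]
    have k4 : a h = c • (h : E) + ψ (a h) • x := by rw [← k1, sub_add_cancel]
    have k5 : a h - a x - χ (a h - a x) • x - d • ((h : E) - x) = 0 := by rw [k2, sub_self]
    rw [← k5]
    nth_rewrite 3 [k4]
    module) 2
  simp at k3

theorem LinearMap.exists_splitting [CharP K 2] [FiniteDimensional K E] (a : Module.End K E)
    (ha : ∀ c : K, a ≠ c • (1 : Module.End K E))
    (htr : LinearMap.trace K E a = 0 ∨ LinearMap.trace K E a = 1) :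
    ∃ L U : Module.End K E, a = L + U ∧
      IsNilpotent (L * (L + 1)) ∧ IsNilpotent (U * (U + 1)) := by
  induction hn : Module.finrank K E using Nat.strong_induction_on generalizing E with
  | _ n ih =>
    obtain ⟨x, hx⟩ : ∃ x, LinearIndependent K ![x, a x] := by
      by_contra! h
      obtain ⟨c, hc⟩ := LinearMap.exists_eq_smul_id_of_forall_notLinearIndependent h
      exact ha c hc
    obtain ⟨ψ, h1, h0, h⟩ := LinearMap.exists_dual_kerProj_ne_smul_one a x hx
    have htr' := htr
    rw [← LinearMap.trace_kerProj_comp a ψ x h1 h0] at htr'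
    refine LinearMap.exists_splitting_of_kerProj a ψ x h1 h0 ?_
    by_cases hc : ∀ c : K, ψ.kerProj x h1 ∘ₗ a ∘ₗ (LinearMap.ker ψ).subtype ≠
        c • (1 : Module.End K _)
    · refine ih _ ?_ _ hc htr' rfl
      rw [← hn]
      refine Submodule.finrank_lt fun h => ?_
      have : x ∈ LinearMap.ker ψ := h ▸ Submodule.mem_top
      rw [LinearMap.mem_ker, h1] at this
      exact one_ne_zero this
    · have hd := h.resolve_left hc
      push Not at hc
      obtain ⟨c, hc⟩ := hc
      rw [hc, map_smul, LinearMap.trace_one, hd, Nat.cast_one, smul_eq_mul, mul_one] at htr'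
      rw [hc]
      exact LinearMap.exists_splitting_smul_one htr'

end Splitting

/-! ### The case of a scalar induced endomorphism -/

section Scalar

variable {K V E : Type*} [Field K] [CharP K 2] [AddCommGroup V] [Module K V]
  [AddCommGroup E] [Module K E]

/-- This decomposes the block matrix `l • diag(1, 1, 0)`; the summands have block ranks 1, 1 and 2.
-/
theorem LinearMap.exists_three_idempotents_of_dual_triple {l : K} (hl : l ≠ 0)
    {x y z : E →ₗ[K] V} {f g h : V →ₗ[K] E}
    (fx : f ∘ₗ x = .id) (fy : f ∘ₗ y = 0) (fz : f ∘ₗ z = 0)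
    (gx : g ∘ₗ x = 0) (gy : g ∘ₗ y = .id) (gz : g ∘ₗ z = 0)
    (hx : h ∘ₗ x = 0) (hy : h ∘ₗ y = 0) (hz : h ∘ₗ z = .id) :
    ∃ p q r : Module.End K V, IsIdempotentElem p ∧ IsIdempotentElem q ∧ IsIdempotentElem r ∧
      l • (x ∘ₗ f + y ∘ₗ g) = p + q + r := by
  have two : (2 : K) = 0 := CharTwo.two_eq_zero
  have key : ∀ (c : E →ₗ[K] V) (d : V →ₗ[K] E), d ∘ₗ c = .id →
      IsIdempotentElem (c ∘ₗ d : Module.End K V) := by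
    intro c d hcd
    ext v
    exact congrArg c (LinearMap.congr_fun hcd (d v))
  have key2 : ∀ (c c' : E →ₗ[K] V) (d d' : V →ₗ[K] E), d ∘ₗ c = .id → d' ∘ₗ c' = .id →
      d ∘ₗ c' = 0 → d' ∘ₗ c = 0 → IsIdempotentElem (c ∘ₗ d + c' ∘ₗ d' : Module.End K V) := by
    intro c c' d d' h1 h2 h3 h4
    replace h1 := LinearMap.congr_fun h1
    replace h2 := LinearMap.congr_fun h2
    replace h3 := LinearMap.congr_fun h3
    replace h4 := LinearMap.congr_fun h4
    simp only [LinearMap.comp_apply, LinearMap.id_apply, LinearMap.zero_apply] at h1 h2 h3 h4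
    ext v
    simp [h1, h2, h3, h4]
  refine ⟨(((l + 1) * l⁻¹) • y + l⁻¹ • z) ∘ₗ (f + l • h),
    ((l ^ 2 + l) • x + z) ∘ₗ (g + h),
    (l • x + ((l + 1) * l⁻¹) • y + l⁻¹ • z) ∘ₗ (f + (l + 1) • g + (l + 1) • h) +
      (l⁻¹ • y + l⁻¹ • z) ∘ₗ (g + (l + 1) • h), key _ _ ?_, key _ _ ?_, key2 _ _ _ _ ?_ ?_ ?_ ?_, ?_⟩
  case refine_7 =>
    ext v
    simp only [LinearMap.add_apply, LinearMap.comp_apply, LinearMap.smul_apply, map_add, map_smul]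
    match_scalars <;> field_simp <;> grind
  all_goals
    simp only [LinearMap.add_comp, LinearMap.comp_add, LinearMap.smul_comp, LinearMap.comp_smul,
      fx, fy, fz, gx, gy, gz, hx, hy, hz, smul_zero, add_zero, zero_add]
  all_goals match_scalars <;> field_simp <;> grind

theorem LinearMap.exists_three_idempotents_of_comp_eq_smul [FiniteDimensional K E]
    (hV : ¬ FiniteDimensional K V) (X : E →ₗ[K] V) (Y : V →ₗ[K] E) {l : K} (hl : l ≠ 0)
    (hYX : Y ∘ₗ X = l • LinearMap.id) (hE : Even (Module.finrank K E)) :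
    ∃ p q r : Module.End K V, IsIdempotentElem p ∧ IsIdempotentElem q ∧ IsIdempotentElem r ∧
      X ∘ₗ Y = p + q + r := by
  obtain ⟨m, hm⟩ := hE
  let e : E ≃ₗ[K] (Fin m → K) × (Fin m → K) := LinearEquiv.ofFinrankEq _ _ (by simp [hm])
  -- The third block, on which `X ∘ₗ Y` vanishes, is found in the infinite-dimensional `ker Y`.
  obtain ⟨ζ, hζ, hYζ, -⟩ := Submodule.exists_injective_ker_disjoint hV Y ⊥ (Fin m → K)
  obtain ⟨τ, hτ⟩ := LinearMap.exists_leftInverse_of_injective ζ (LinearMap.ker_eq_bot.mpr hζ)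
  have yx : ∀ v, Y (X v) = l • v := LinearMap.congr_fun hYX
  have yz : ∀ v, Y (ζ v) = 0 := LinearMap.congr_fun hYζ
  have tz : ∀ v, τ (ζ v) = v := LinearMap.congr_fun hτ
  obtain ⟨p, q, r, hp, hq, hr, h⟩ := LinearMap.exists_three_idempotents_of_dual_triple hl
    (x := X ∘ₗ e.symm.toLinearMap ∘ₗ .inl K _ _) (y := X ∘ₗ e.symm.toLinearMap ∘ₗ .inr K _ _)
    (z := ζ) (f := l⁻¹ • (.fst K _ _ ∘ₗ e.toLinearMap ∘ₗ Y))
    (g := l⁻¹ • (.snd K _ _ ∘ₗ e.toLinearMap ∘ₗ Y))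
    (h := τ ∘ₗ (.id - l⁻¹ • (X ∘ₗ Y)))
    (by refine LinearMap.ext fun v => ?_; simp [yx, hl])
    (by refine LinearMap.ext fun v => ?_; simp [yx])
    (by refine LinearMap.ext fun v => ?_; simp [yz])
    (by refine LinearMap.ext fun v => ?_; simp [yx])
    (by refine LinearMap.ext fun v => ?_; simp [yx, hl])
    (by refine LinearMap.ext fun v => ?_; simp [yz])
    (by refine LinearMap.ext fun v => ?_; simp [yx, hl])
    (by refine LinearMap.ext fun v => ?_; simp [yx, hl])
    (by refine LinearMap.ext fun v => ?_; simp [yz, tz])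
  refine ⟨p, q, r, hp, hq, hr, ?_⟩
  rw [← h]
  ext v
  simp only [LinearMap.smul_apply, LinearMap.add_apply, LinearMap.comp_apply, map_smul,
    ← smul_add, ← map_add, smul_inv_smul₀ hl]
  simp

end Scalar

/-! ### Assembling the cases -/

section Main

variable {K V : Type*} [Field K] [CharP K 2] [AddCommGroup V] [Module K V]

theorem LinearMap.exists_three_idempotents_of_finiteRank (hV : ¬ FiniteDimensional K V)
    (u : V →ₗ[K] V) (hu : FiniteDimensional K (LinearMap.range u))
    (htr : finiteRankTrace u = 0 ∨ finiteRankTrace u = 1) :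
    ∃ p q r : Module.End K V, IsIdempotentElem p ∧ IsIdempotentElem q ∧ IsIdempotentElem r ∧
      u = p + q + r := by
  let X : LinearMap.range u →ₗ[K] V := (LinearMap.range u).subtype
  let Y : V →ₗ[K] LinearMap.range u := u.rangeRestrict
  have hX : Function.Injective X := (LinearMap.range u).injective_subtype
  have hY : Function.Surjective Y := u.surjective_rangeRestrict
  have hXY : u = X ∘ₗ Y := rfl
  have htr' : LinearMap.trace K _ (Y ∘ₗ X) = 0 ∨ LinearMap.trace K _ (Y ∘ₗ X) = 1 := htr
  by_cases hc : ∀ c : K, Y ∘ₗ X ≠ c • (1 : Module.End K (LinearMap.range u))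
  · obtain ⟨L, U, h, hL, hU⟩ := LinearMap.exists_splitting _ hc htr'
    rw [hXY]
    exact LinearMap.exists_three_idempotents_of_comp_eq_add hV X Y hX hY L U h hL hU
  · push Not at hc
    obtain ⟨c, hc⟩ := hc
    by_cases hc01 : c = 0 ∨ c = 1
    · obtain ⟨L, U, h, hL, hU⟩ := LinearMap.exists_splitting_smul_one (E := LinearMap.range u) hc01
      rw [hXY]
      exact LinearMap.exists_three_idempotents_of_comp_eq_add hV X Y hX hY L U (hc.trans h) hL hU
    · rw [hXY]
      refine LinearMap.exists_three_idempotents_of_comp_eq_smul hV X Y (l := c)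
        (fun h => hc01 (.inl h)) hc ?_
      -- In odd dimension the trace of `c • 1` would be `c` itself, which is neither 0 nor 1.
      by_contra hodd
      rw [Nat.not_even_iff_odd] at hodd
      obtain ⟨m, hm⟩ := hodd
      rw [hc, map_smul, LinearMap.trace_one, hm] at htr'
      simp only [Nat.cast_add, Nat.cast_mul, Nat.cast_ofNat, CharTwo.two_eq_zero, zero_mul,
        zero_add, Nat.cast_one, smul_eq_mul, mul_one] at htr'
      exact hc01 htr'

end Main

theorem mainTheorem8 {K V : Type*} [Field K] [CharP K 2] [AddCommGroup V] [Module K V]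
    (hV : ¬ FiniteDimensional K V) (α : K) (hα : α = 0 ∨ α = 1)
    (u : V →ₗ[K] V) (hu : FiniteDimensional K (LinearMap.range u))
    (htr : finiteRankTrace u = 0 ∨ finiteRankTrace u = 1) :
    ∃ p q r : V →ₗ[K] V, p ∘ₗ p = p ∧ q ∘ₗ q = q ∧ r ∘ₗ r = r ∧
      α • (LinearMap.id : V →ₗ[K] V) + u = p + q + r := by
  obtain ⟨p, q, r, hp, hq, hr, rfl⟩ := LinearMap.exists_three_idempotents_of_finiteRank hV u hu htr
  rcases hα with rfl | rfl
  · exact ⟨p, q, r, hp, hq, hr, by rw [zero_smul, zero_add]⟩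
  -- In characteristic 2 the identity is absorbed, since `1 + p = 1 - p` is idempotent.
  · refine ⟨1 - p, q, r, hp.one_sub, hq, hr, ?_⟩
    have hneg : -p = p := by
      ext v
      rw [LinearMap.neg_apply, ← neg_one_smul K (p v), CharTwo.neg_eq, one_smul]
    rw [sub_eq_add_neg, hneg, one_smul, ← Module.End.one_eq_id, add_assoc, add_assoc, add_assoc]
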